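/- **Theorem (Linear Talagrand's Inequality, with exceptional outcomes).** Let $((\Omega_i,\Sigma_i,\mathbb P_i))_{i=1}^n$ be probability spaces, let $(\Omega,\Sigma,\mathbb P)$ be their product space, let $\Omega^*\subseteq\Omega$ be a set of exceptional outcomes, let $X:\Omega\to\mathbb R_{\ge 0}$ be a non-negative random variable with finite expectation, and let $r,d\ge 0$ be real numbers. For $\omega\in\Omega$ and $s>0$, an *$(r,d)$-certificate* for $X,\omega,s$ and $\Omega^*$ is an index set $I\subseteq\{1,\dots,n\}$ together with a real vector $(c_i : i\in I)$ with $\sum_{i\in I}c_i\le rs$ and $c_i\le d$ for all $i\in I$, such that for all $I'\subseteq I$ we have $$X(\omega')\ \ge\ s-\sum_{i\in I'}c_i$$ for all $\omega'\in\Omega\setminus\Omega^*$ with $\omega_i=\omega'_i$ for all $i\in I\setminus I'$. The variable $X$ is *$(r,d)$-observable* with respect to $\Omega^*$ if for every $s>0$ and every $\omega\in\Omega\setminus\Omega^*$ with $X(\omega)\ge s$ there exists an $(r,d)$-certificate for $X,\omega,s$ and $\Omega^*$. If $X$ is $(r,d)$-observable with respect to $\Omega^*$, then for every real $$t>96\sqrt{rd\,\mathbb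 E[X]}+128\,rd+8\,\mathbb P(\Omega^*)\cdot\sup X,$$ (where $\sup X\in[0,\infty]$ and $0\cdot\infty=0$) we have $$\mathbb P\big(|X-\mathbb E[X]|>t\big)\ \le\ 4\exp\left(\frac{-t^2}{8rd\,(4\mathbb E[X]+t)}\right)+4\,\mathbb P(\Omega^*),$$ where for $rd=0$ the exponential term is read as $0$. -/

import Mathlib

open MeasureTheory
open scoped ENNReal

/-- The index set `I` together with the weights `c i`, `i ∈ I`, is an `(r, d)`-certificate for the
function `X`, the outcome `ω`, the level `s` and the set `Ωs` of exceptional outcomes.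
Only the values of `c` on `I` matter. -/
structure IsObsCertificate {n : ℕ} {Ω : Fin n → Type*} (r d : ℝ) (X : (∀ i, Ω i) → ℝ)
    (Ωs : Set (∀ i, Ω i)) (ω : ∀ i, Ω i) (s : ℝ) (I : Finset (Fin n)) (c : Fin n → ℝ) :
    Prop where
  sum_le : ∑ i ∈ I, c i ≤ r * s
  le_max : ∀ i ∈ I, c i ≤ d
  certifies : ∀ I' : Finset (Fin n), I' ⊆ I → ∀ ω' : ∀ i, Ω i, ω' ∉ Ωs →
    (∀ i ∈ I \ I', ω i = ω' i) → s - ∑ i ∈ I', c i ≤ X ω'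

/-- `X` is `(r, d)`-observable with respect to the set `Ωs` of exceptional outcomes. -/
def IsObservable {n : ℕ} {Ω : Fin n → Type*} (r d : ℝ) (X : (∀ i, Ω i) → ℝ)
    (Ωs : Set (∀ i, Ω i)) : Prop :=
  ∀ s : ℝ, 0 < s → ∀ ω : ∀ i, Ω i, ω ∉ Ωs → s ≤ X ω →
    ∃ (I : Finset (Fin n)) (c : Fin n → ℝ), IsObsCertificate r d X Ωs ω s I c

/-!
The proof rests on Talagrand's inequality for the convex distance on a product space: if `d_A ω`
denotes the convex distance from `ω` to `A`, then `P A * ∫ exp (d_A ^ 2 / 4) ≤ 1`. For arbitrary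
factors the distance `d_A` need not be measurable, since it involves projections of `A`. The
function constructed in `exists_measurable_convexDistance_bound` is a measurable majorant of
`exp (d_A ^ 2 / 4)` with the same bound on its integral. It is built one coordinate at a time, with
the remaining coordinates as parameters (`lmarginal`), from the sections of `A` and from its
essential projection, the set of points with a section of positive measure. The latter is
measurable, contains almost all of `A`, and consists of points that can be lifted to `A`; this is
all that Talagrand's induction uses. The convex distance is expressed through its dual description
`d_A ω ^ 2 = sup (2 * τ - ‖c‖ ^ 2)` over weights `c ≥ 0` whose Hamming distance from `ω` to `A` is at
least `τ`, which makes the geometric part of the induction step the inequality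
`0 ≤ (1 - λ - c i) ^ 2`.

For an observable `X` and an outcome `ω` that is not exceptional, a certificate at the level
`s = X ω` provides such weights with `‖c‖ ^ 2 ≤ r * d * X ω`
(`IsObservable.exists_weights`). Off the exceptional set `S`, this gives
`P (X ≤ a) * P (X ≥ a + u) ≤ exp (-u ^ 2 / (4 * r * d * (a + u)))`
(`IsObservable.measure_mul_measure_le`). Take `a = m` and `a = m - u` for a median `m`. Markov's
inequality gives `m ≤ 2 * E[X]`, so both tails of `X` around `m` are of the claimed order.
Integrating the tails off `S`, and bounding `|X - m|` by `sup X` on `S`, shows that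
`|E[X] - m| ≤ t / 2`. Hence `|X - E[X]| > t` forces `|X - m| ≥ t / 2`, and the exponent for
`u = t / 2` is exactly the one claimed (`measure_abs_sub_integral_le_of_level_sets`).
-/

/-! ### The numerical inequality for the induction step -/

/-- The exponent `λ ∈ [0, 1]` at which `ρ ^ (-λ) * exp ((1 - λ) ^ 2 / 4)` is minimal, for
`ρ ∈ (0, 1]`. It is `0` at `ρ = 0`, and the cap at `1` keeps it in `[0, 1]` for `ρ > 1`. -/
noncomputable def talagrandExponent (ρ : ℝ) : ℝ :=
  if ρ ≤ Real.exp (-1 / 2) then 0 else min 1 (1 + 2 * Real.log ρ)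

lemma measurable_talagrandExponent : Measurable talagrandExponent := by
  unfold talagrandExponent
  exact Measurable.ite measurableSet_Iic measurable_const (by fun_prop)

lemma talagrandExponent_mem_Icc (ρ : ℝ) : talagrandExponent ρ ∈ Set.Icc (0 : ℝ) 1 := by
  unfold talagrandExponent
  split_ifs with h
  · simp
  · have h' := Real.lt_log_iff_exp_lt ((Real.exp_pos _).trans (not_le.1 h)) |>.2 (not_le.1 h)
    exact ⟨le_min zero_le_one (by linarith), min_le_left _ _⟩

lemma exp_le_one_add_add_sq_mul {y : ℝ} (h0 : 0 ≤ y) (h1 : y ≤ 1) :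
    Real.exp y ≤ 1 + y + y ^ 2 / 2 + y ^ 3 * (2 / 9) := by
  have h := Real.exp_bound' h0 h1 (n := 3) (by norm_num)
  norm_num [Finset.sum_range_succ, Nat.factorial] at h
  linarith

lemma exp_neg_le_one_sub_add {x : ℝ} (h0 : 0 ≤ x) : Real.exp (-x) ≤ 1 - x + x ^ 2 / 2 := by
  have h := Real.quadratic_le_exp_of_nonneg h0
  rw [Real.exp_neg, inv_le_iff_one_le_mul₀ (Real.exp_pos x)]
  have h2 : 0 < 1 - x + x ^ 2 / 2 := by nlinarith [sq_nonneg (x - 1)]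
  nlinarith [mul_le_mul_of_nonneg_left h h2.le, sq_nonneg (x ^ 2)]

/-- The numerical inequality behind the induction step for the convex distance. -/
lemma rpow_neg_talagrandExponent_mul_exp_le {ρ : ℝ} (h0 : 0 ≤ ρ) (h1 : ρ ≤ 1) :
    ρ ^ (-talagrandExponent ρ) * Real.exp ((1 - talagrandExponent ρ) ^ 2 / 4) ≤ 2 - ρ := by
  unfold talagrandExponent
  split_ifs with h
  · have h2 := exp_neg_le_one_sub_add (x := 1 / 2) (by norm_num)
    have h3 := exp_le_one_add_add_sq_mul (y := 1 / 4) (by norm_num) (by norm_num)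
    norm_num at h2 h3 h ⊢
    linarith
  · have hρ : 0 < ρ := (Real.exp_pos _).trans (not_le.1 h)
    obtain ⟨x, rfl⟩ : ∃ x, ρ = Real.exp (-x) := ⟨-Real.log ρ, by simp [Real.exp_log hρ]⟩
    have hx0 : 0 ≤ x := by
      have := Real.exp_le_one_iff.1 h1
      linarith
    have hx1 : x < 1 / 2 := by
      have := Real.exp_lt_exp.1 (not_le.1 h)
      linarith
    rw [Real.log_exp, min_eq_right (by linarith), ← Real.exp_mul, ← Real.exp_add]
    have e : -x * -(1 + 2 * -x) + (1 - (1 + 2 * -x)) ^ 2 / 4 = x * (1 - x) := by ring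
    rw [e]
    have h2 := exp_neg_le_one_sub_add hx0
    have hy0 : 0 ≤ x * (1 - x) := mul_nonneg hx0 (by linarith)
    have h3 := exp_le_one_add_add_sq_mul (y := x * (1 - x)) hy0 (by nlinarith)
    have h4 : (x * (1 - x)) ^ 2 / 2 + (x * (1 - x)) ^ 3 * (2 / 9) ≤ x ^ 2 / 2 := by
      have h5 : (1 - x) ^ 2 + 4 / 9 * (x * (1 - x) ^ 3) ≤ 1 := by
        have : (1 - x) ^ 3 ≤ 1 := pow_le_one₀ (by linarith) (by linarith)
        nlinarith
      nlinarith [mul_le_mul_of_nonneg_left h5 (sq_nonneg x)]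
    linarith

/-- If `x ≤ a⁻¹` and `y ≤ b⁻¹` with `a ≤ b`, then a suitable geometric mean of `x` and `y`,
multiplied by the price `exp ((1 - λ) ^ 2 / 4)` of moving one coordinate, is at most
`b⁻¹ * (2 - a / b)`. -/
lemma mul_talagrand_mean_add_div_le_two {a b x y : ℝ≥0∞} (hab : a ≤ b) (hb0 : b ≠ 0) (hb : b ≠ ∞)
    (hx : a * x ≤ 1) (hy : b * y ≤ 1) {l : ℝ} (hl : l = talagrandExponent (a / b).toReal) :
    b * (x ^ l * y ^ (1 - l) * ENNReal.ofReal (Real.exp ((1 - l) ^ 2 / 4))) + a / b ≤ 2 := by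
  have hdiv : a / b ≤ 1 := ENNReal.div_le_of_le_mul (by simpa using hab)
  have hdivt : a / b ≠ ∞ := ne_top_of_le_ne_top ENNReal.one_ne_top hdiv
  set ρ := (a / b).toReal with hρ
  have hab' : a / b = ENNReal.ofReal ρ := (ENNReal.ofReal_toReal hdivt).symm
  have hρ0 : 0 ≤ ρ := ENNReal.toReal_nonneg
  have hρ1 : ρ ≤ 1 := ENNReal.toReal_le_of_le_ofReal zero_le_one (by simpa using hdiv)
  have hl01 := talagrandExponent_mem_Icc ρ
  have key := rpow_neg_talagrandExponent_mul_exp_le hρ0 hρ1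
  rw [← hl] at hl01 key
  have hy' : y ≤ b⁻¹ := by
    rw [ENNReal.le_inv_iff_mul_le, mul_comm]; exact hy
  have hx' : x ^ l ≤ (b⁻¹) ^ l * ENNReal.ofReal (ρ ^ (-l)) := by
    rcases hl01.1.eq_or_lt with h0 | h0
    · simp [← h0]
    · have hρpos : 0 < ρ := by
        rcases hρ0.eq_or_lt with h | h
        · rw [hl, ← h, talagrandExponent, if_pos (Real.exp_pos _).le] at h0
          exact absurd h0 (lt_irrefl _)
        · exact h
      have hx2 : x ≤ b⁻¹ * ENNReal.ofReal ρ⁻¹ := by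
        rw [ENNReal.ofReal_inv_of_pos hρpos, ← hab', ENNReal.inv_div (Or.inl hb) (Or.inl hb0),
          ENNReal.div_eq_inv_mul, mul_left_comm, ENNReal.inv_mul_cancel hb0 hb, mul_one,
          ENNReal.le_inv_iff_mul_le, mul_comm]
        exact hx
      calc x ^ l ≤ (b⁻¹ * ENNReal.ofReal ρ⁻¹) ^ l := ENNReal.rpow_le_rpow hx2 hl01.1
        _ = _ := by
          rw [ENNReal.mul_rpow_of_nonneg _ _ hl01.1, ENNReal.ofReal_rpow_of_pos (inv_pos.2 hρpos),
            Real.inv_rpow hρ0, Real.rpow_neg hρ0]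
  have hy2 : y ^ (1 - l) ≤ (b⁻¹) ^ (1 - l) := ENNReal.rpow_le_rpow hy' (by linarith [hl01.2])
  have hb1 : (b⁻¹) ^ l * (b⁻¹) ^ (1 - l) = b⁻¹ := by
    rw [← ENNReal.rpow_add_of_nonneg _ _ hl01.1 (by linarith [hl01.2])]; simp
  calc b * (x ^ l * y ^ (1 - l) * ENNReal.ofReal (Real.exp ((1 - l) ^ 2 / 4))) + a / b
      ≤ b * ((b⁻¹) ^ l * ENNReal.ofReal (ρ ^ (-l)) * (b⁻¹) ^ (1 - l)
          * ENNReal.ofReal (Real.exp ((1 - l) ^ 2 / 4))) + a / b := by gcongr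
    _ = b * ((b⁻¹) ^ l * (b⁻¹) ^ (1 - l)) *
          ENNReal.ofReal (ρ ^ (-l) * Real.exp ((1 - l) ^ 2 / 4)) + a / b := by
      rw [ENNReal.ofReal_mul (Real.rpow_nonneg hρ0 _)]
      ring
    _ ≤ ENNReal.ofReal (2 - ρ) + ENNReal.ofReal ρ := by
      rw [hb1, ENNReal.mul_inv_cancel hb0 hb, one_mul, hab']
      gcongr
    _ = 2 := by
      rw [← ENNReal.ofReal_add (by linarith) hρ0]; simp

lemma mul_le_one_of_mul_add_div_le_two {α b I : ℝ≥0∞} (hb0 : b ≠ 0) (hb : b ≠ ∞)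
    (h : b * I + α / b ≤ 2) : α * I ≤ 1 := by
  have h1 : b * I ≠ ∞ := ne_top_of_le_ne_top (by simp) (le_self_add.trans h)
  have h2 : α / b ≠ ∞ := ne_top_of_le_ne_top (by simp) (le_add_self.trans h)
  have e : α * I = (b * I) * (α / b) := by
    rw [mul_comm b I, mul_assoc, ENNReal.mul_div_cancel hb0 hb, mul_comm]
  rw [e]
  lift b * I to NNReal using h1 with u
  lift α / b to NNReal using h2 with v
  norm_cast at h ⊢
  have : (u : ℝ) + v ≤ 2 := by exact_mod_cast h
  have : (u : ℝ) * v ≤ 1 := by nlinarith [sq_nonneg ((u : ℝ) - v), u.2, v.2]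
  exact_mod_cast this

/-! ### Talagrand's convex distance inequality -/

lemma lmarginal_indicator_one_le_one {ι : Type*} [DecidableEq ι] {Ω : ι → Type*}
    [∀ i, MeasurableSpace (Ω i)] (μ : ∀ i, Measure (Ω i)) [∀ i, IsProbabilityMeasure (μ i)]
    (s : Finset ι) (A : Set (∀ i, Ω i)) (ω : ∀ i, Ω i) :
    lmarginal μ s (A.indicator 1) ω ≤ 1 := by
  calc lmarginal μ s (A.indicator 1) ω ≤ lmarginal μ s (fun _ ↦ 1) ω :=
        lmarginal_mono (fun _ ↦ Set.indicator_le_self' (by simp) _) ω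
    _ = 1 := by simp [lmarginal]

/-- The essential projection of `A` along the coordinate `i`: the points whose section of `A` in
direction `i` has positive measure. -/
def essProj {ι : Type*} [DecidableEq ι] {Ω : ι → Type*} [∀ i, MeasurableSpace (Ω i)]
    (μ : ∀ i, Measure (Ω i)) (i : ι) (A : Set (∀ i, Ω i)) : Set (∀ i, Ω i) :=
  {ω | lmarginal μ {i} (A.indicator 1) ω ≠ 0}

section
variable {ι : Type*} [DecidableEq ι] {Ω : ι → Type*} [∀ i, MeasurableSpace (Ω i)]
  (μ : ∀ i, Measure (Ω i))

lemma measurableSet_essProj [∀ i, IsProbabilityMeasure (μ i)] (i : ι)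
    {A : Set (∀ i, Ω i)} (hA : MeasurableSet A) : MeasurableSet (essProj μ i A) :=
  (((measurable_one.indicator hA).lmarginal μ) (measurableSet_singleton 0)).compl

lemma exists_update_mem_of_mem_essProj {i : ι} {A : Set (∀ i, Ω i)} {ω : ∀ i, Ω i}
    (h : ω ∈ essProj μ i A) : ∃ y, Function.update ω i y ∈ A := by
  by_contra! hn
  apply h
  rw [lmarginal_singleton]
  simp [hn]

/-- Up to a null set, the set `A` is contained in its essential projection, so almost all sections
of `A` in direction `i` are dominated in measure by the essential projection. -/
lemma ae_lmarginal_update_le_essProj [∀ i, IsProbabilityMeasure (μ i)] (s : Finset ι)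
    {i : ι} (hi : i ∉ s) {A : Set (∀ i, Ω i)} (hA : MeasurableSet A) (ω : ∀ i, Ω i) :
    ∀ᵐ y ∂μ i, lmarginal μ s (A.indicator 1) (Function.update ω i y) ≤
      lmarginal μ s ((essProj μ i A).indicator 1) ω := by
  have hB := measurableSet_essProj μ i hA
  set B := essProj μ i A with hBdef
  have hBupd : ∀ (x : ∀ i, Ω i) y, Function.update x i y ∈ B ↔ x ∈ B := fun x y ↦ by
    simp only [hBdef, essProj, Set.mem_ofPred_eq,
      lmarginal_update_of_mem μ (Finset.mem_singleton_self i)]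
  have hzero : lmarginal μ (insert i s) ((A \ B).indicator 1) ω = 0 := by
    rw [lmarginal_insert' _ (measurable_one.indicator (hA.diff hB)) hi]
    have : (fun x ↦ ∫⁻ y, (A \ B).indicator (1 : (∀ i, Ω i) → ℝ≥0∞) (Function.update x i y) ∂μ i)
        = fun _ ↦ 0 := by
      ext x
      by_cases hx : x ∈ B
      · simp [hBupd, hx]
      · have hx' : lmarginal μ {i} (A.indicator 1) x = 0 := by
          simpa [hBdef, essProj] using hx
        rw [lmarginal_singleton] at hx'
        refine le_antisymm (le_trans (lintegral_mono fun y ↦ ?_) hx'.le) bot_le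
        exact Set.indicator_le_indicator_of_subset Set.sdiff_subset (by simp) _
    rw [this]
    simp [lmarginal]
  rw [lmarginal_insert _ (measurable_one.indicator (hA.diff hB)) hi] at hzero
  have hm : Measurable fun y ↦ lmarginal μ s ((A \ B).indicator 1) (Function.update ω i y) :=
    ((measurable_one.indicator (hA.diff hB)).lmarginal μ).comp (measurable_update ω)
  filter_upwards [(lintegral_eq_zero_iff hm).1 hzero] with y hy
  have hyB : lmarginal μ s (B.indicator 1) (Function.update ω i y) =
      lmarginal μ s (B.indicator 1) ω := by
    rw [lmarginal_update_of_notMem (measurable_one.indicator hB) hi]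
    congr 1
    ext x
    by_cases hx : x ∈ B <;> simp [hBupd, hx]
  rw [← hyB]
  calc lmarginal μ s (A.indicator 1) (Function.update ω i y)
      ≤ lmarginal μ s (fun x ↦ (A \ B).indicator 1 x + B.indicator 1 x) (Function.update ω i y) := by
        refine lmarginal_mono (fun x ↦ ?_) _
        by_cases hxA : x ∈ A <;> by_cases hxB : x ∈ B <;> simp [hxA, hxB]
    _ = lmarginal μ s ((A \ B).indicator 1) (Function.update ω i y) +
        lmarginal μ s (B.indicator 1) (Function.update ω i y) := by
        unfold lmarginal
        exact lintegral_add_right _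
          ((measurable_one.indicator hB).comp measurable_updateFinset)
    _ = _ := by
        simp only [Pi.zero_apply] at hy
        rw [hy, zero_add]

/-- Hölder's inequality for marginals, with an exponent and a factor that do not depend on the
coordinates integrated out. -/
lemma lmarginal_rpow_mul_rpow_mul_le (s : Finset ι) {F G : (∀ i, Ω i) → ℝ≥0∞} (hF : Measurable F)
    (hG : Measurable G) {l : (∀ i, Ω i) → ℝ} (hl : ∀ ω, l ω ∈ Set.Icc (0 : ℝ) 1)
    (hls : ∀ ω ω', (∀ i ∉ s, ω i = ω' i) → l ω = l ω') (K : ℝ → ℝ≥0∞) (hK : ∀ t, K t ≠ ∞)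
    (ω : ∀ i, Ω i) :
    lmarginal μ s (fun x ↦ F x ^ l x * G x ^ (1 - l x) * K (l x)) ω ≤
      lmarginal μ s F ω ^ l ω * lmarginal μ s G ω ^ (1 - l ω) * K (l ω) := by
  have hconst : ∀ y, l (Function.updateFinset ω s y) = l ω := fun y ↦
    hls _ _ fun i hi ↦ by simp [Function.updateFinset, hi]
  unfold lmarginal
  simp only [hconst]
  rw [lintegral_mul_const' _ _ (hK _)]
  gcongr
  exact ENNReal.lintegral_mul_norm_pow_le (hF.comp measurable_updateFinset).aemeasurable
    (hG.comp measurable_updateFinset).aemeasurable (hl ω).1 (by linarith [(hl ω).2]) (by ring)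

end

/-- Talagrand's inequality for the convex distance, in a form that needs no measurability of the
distance itself. The function `G` is a measurable majorant of `exp (d ^ 2 / 4)`, where `d` is the
convex distance to `A` in the coordinates of `s`, the other coordinates being frozen; the distance
enters through the linear functionals `c` that witness it, by `d ^ 2 = sup (2 * τ - ‖c‖ ^ 2)`. -/
theorem exists_measurable_convexDistance_bound {ι : Type*} [DecidableEq ι] {Ω : ι → Type*}
    [∀ i, MeasurableSpace (Ω i)] (μ : ∀ i, Measure (Ω i)) [∀ i, IsProbabilityMeasure (μ i)]
    (s : Finset ι) : ∀ A : Set (∀ i, Ω i), MeasurableSet A →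
    ∃ G : (∀ i, Ω i) → ℝ≥0∞, Measurable G ∧
      (∀ ω, lmarginal μ s (A.indicator 1) ω * lmarginal μ s G ω ≤ 1) ∧
      ∀ (ω : ∀ i, Ω i) (c : ι → ℝ) (τ : ℝ), (∀ i, 0 ≤ c i) →
        (∀ ω' ∈ A, (∀ i ∉ s, ω i = ω' i) → τ ≤ ∑ i ∈ s, {i | ω i ≠ ω' i}.indicator c i) →
        ENNReal.ofReal (Real.exp ((2 * τ - ∑ i ∈ s, c i ^ 2) / 4)) ≤ G ω := by
  induction s using Finset.induction with
  | empty =>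
    intro A hA
    refine ⟨fun ω ↦ A.indicator 1 ω + Aᶜ.indicator (fun _ ↦ ∞) ω,
      (measurable_one.indicator hA).add (measurable_const.indicator hA.compl), fun ω ↦ ?_,
      fun ω c τ _ h ↦ ?_⟩
    · by_cases hω : ω ∈ A <;> simp [hω]
    · by_cases hω : ω ∈ A
      · have := h ω hω (by simp)
        simp only [Finset.sum_empty] at this
        simp [hω]
        linarith
      · simp [hω]
  | insert i s hi ih =>
    intro A hA
    have hB := measurableSet_essProj μ i hA
    set B := essProj μ i A with hBdef
    obtain ⟨F, hF, hFA, hFd⟩ := ih A hA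
    obtain ⟨G, hG, hGB, hGd⟩ := ih B hB
    set a := lmarginal μ s (A.indicator 1) with ha
    set b := lmarginal μ s (B.indicator 1) with hb
    have ham : Measurable a := (measurable_one.indicator hA).lmarginal μ
    have hbm : Measurable b := (measurable_one.indicator hB).lmarginal μ
    -- The weight of the section against the projection depends on the frozen coordinates only,
    -- through the ratio of their measures.
    set l : (∀ i, Ω i) → ℝ := fun ω ↦ talagrandExponent (a ω / b ω).toReal with hl
    have hlm : Measurable l := measurable_talagrandExponent.comp (ham.div hbm).ennreal_toReal
    have hl01 : ∀ ω, l ω ∈ Set.Icc (0 : ℝ) 1 := fun ω ↦ talagrandExponent_mem_Icc _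
    have hls : ∀ ω ω', (∀ j ∉ s, ω j = ω' j) → l ω = l ω' := fun ω ω' h ↦ by
      simp only [hl, ha, hb, lmarginal_congr μ _ h]
    set K : ℝ → ℝ≥0∞ := fun t ↦ ENNReal.ofReal (Real.exp ((1 - t) ^ 2 / 4)) with hK
    have hKm : Measurable K := by fun_prop
    set H : (∀ i, Ω i) → ℝ≥0∞ := fun x ↦ F x ^ l x * G x ^ (1 - l x) * K (l x) with hH
    have hHm : Measurable H :=
      ((hF.pow hlm).mul (hG.pow (measurable_const.sub hlm))).mul (hKm.comp hlm)
    refine ⟨H, hHm, fun ω ↦ ?_, fun ω c τ hc h ↦ ?_⟩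
    · have hbω : ∀ y, b (Function.update ω i y) = b ω := fun y ↦ by
        rw [hb, lmarginal_update_of_notMem (measurable_one.indicator hB) hi]
        congr 1
        ext x
        simp only [Function.comp, Set.indicator, hBdef, essProj, Set.mem_ofPred_eq,
          lmarginal_update_of_mem μ (Finset.mem_singleton_self i), Pi.one_apply]
      have hae := ae_lmarginal_update_le_essProj μ s hi hA ω
      have hb1 : b ω ≠ ∞ :=
        ne_top_of_le_ne_top ENNReal.one_ne_top (lmarginal_indicator_one_le_one μ s B ω)
      rw [lmarginal_insert _ (measurable_one.indicator hA) hi, lmarginal_insert _ hHm hi]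
      by_cases hb0 : b ω = 0
      · have : ∫⁻ y, lmarginal μ s (A.indicator 1) (Function.update ω i y) ∂μ i = 0 := by
          refine (lintegral_congr_ae ?_).trans lintegral_zero
          filter_upwards [hae] with y hy
          exact le_antisymm (hy.trans hb0.le) bot_le
        rw [this, zero_mul]
        exact zero_le_one
      · refine mul_le_one_of_mul_add_div_le_two hb0 hb1 ?_
        have hHmarg : Measurable fun y ↦ lmarginal μ s H (Function.update ω i y) :=
          (hHm.lmarginal μ).comp (measurable_update ω)
        simp only [div_eq_mul_inv]
        rw [← lintegral_const_mul' _ _ hb1, ← lintegral_mul_const' _ _ (ENNReal.inv_ne_top.2 hb0),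
          ← lintegral_add_left (hHmarg.const_mul _)]
        calc _ ≤ ∫⁻ _, 2 ∂μ i := by
              refine lintegral_mono_ae ?_
              filter_upwards [hae] with y hy
              set x := Function.update ω i y
              have hGx := hGB x
              rw [← hbω y] at hb0 hb1 ⊢
              change a x ≤ b ω at hy
              rw [← hbω y] at hy
              refine le_trans ?_ (mul_talagrand_mean_add_div_le_two hy hb0 hb1 (hFA x) hGx
                (l := l x) rfl)
              refine add_le_add ?_ (le_of_eq (div_eq_mul_inv _ _).symm)
              gcongr
              exact lmarginal_rpow_mul_rpow_mul_le μ s hF hG hl01 hls K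
                (fun _ ↦ ENNReal.ofReal_ne_top) x
          _ = 2 := by simp
    · -- A point of `A` that agrees with `ω` at `i` costs nothing at `i`, while a point of the
      -- essential projection costs at most `c i` more to be lifted to `A`.
      have h1 := hFd ω c τ hc fun ω' hω' hag ↦ by
        have hi' := hag i hi
        have := h ω' hω' fun j hj ↦ hag j (fun hjs ↦ hj (Finset.mem_insert_of_mem hjs))
        rwa [Finset.sum_insert hi, Set.indicator_of_notMem (by simp [hi']), zero_add] at this
      have h2 := hGd ω c (τ - c i) hc fun ω' hω' hag ↦ by
        obtain ⟨y, hy⟩ := exists_update_mem_of_mem_essProj μ hω'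
        have := h _ hy fun j hj ↦ by
          rw [Finset.mem_insert, not_or] at hj
          rw [Function.update_of_ne hj.1]
          exact hag j hj.2
        rw [Finset.sum_insert hi] at this
        have e : ∑ j ∈ s, {j | ω j ≠ Function.update ω' i y j}.indicator c j =
            ∑ j ∈ s, {j | ω j ≠ ω' j}.indicator c j := by
          refine Finset.sum_congr rfl fun j hj ↦ ?_
          have hji : j ≠ i := fun e ↦ hi (e ▸ hj)
          have hiff : j ∈ {j | ω j ≠ Function.update ω' i y j} ↔ j ∈ {j | ω j ≠ ω' j} := by
            rw [Set.mem_ofPred_eq, Set.mem_ofPred_eq, Function.update_of_ne hji]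
          by_cases hmem : j ∈ {j | ω j ≠ ω' j}
          · rw [Set.indicator_of_mem hmem, Set.indicator_of_mem (hiff.2 hmem)]
          · rw [Set.indicator_of_notMem hmem, Set.indicator_of_notMem (mt hiff.1 hmem)]
        rw [e] at this
        have hci : {j | ω j ≠ Function.update ω' i y j}.indicator c i ≤ c i :=
          Set.indicator_le_self' (fun _ _ ↦ hc i) i
        linarith
      obtain ⟨hl0, hl1⟩ := hl01 ω
      simp only [hH, hK]
      refine le_trans ?_ (mul_le_mul' (mul_le_mul' (ENNReal.rpow_le_rpow h1 hl0)
        (ENNReal.rpow_le_rpow h2 (sub_nonneg.2 hl1))) le_rfl)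
      rw [ENNReal.ofReal_rpow_of_pos (Real.exp_pos _), ENNReal.ofReal_rpow_of_pos (Real.exp_pos _),
        ← Real.exp_mul, ← Real.exp_mul, ← ENNReal.ofReal_mul (Real.exp_pos _).le,
        ← ENNReal.ofReal_mul (by positivity), ← Real.exp_add, ← Real.exp_add]
      refine ENNReal.ofReal_le_ofReal (Real.exp_le_exp.2 ?_)
      rw [Finset.sum_insert hi]
      nlinarith [sq_nonneg (1 - l ω - c i)]

/-! ### Level sets of observable functions -/

lemma IsObservable.mono_exceptional {n : ℕ} {Ω : Fin n → Type*} {r d : ℝ} {X : (∀ i, Ω i) → ℝ}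
    {S T : Set (∀ i, Ω i)} (hST : S ⊆ T) (h : IsObservable r d X S) : IsObservable r d X T := by
  intro s hs ω hω hX
  obtain ⟨I, c, hc⟩ := h s hs ω (fun h ↦ hω (hST h)) hX
  exact ⟨I, c, hc.sum_le, hc.le_max, fun I' hI' ω' hω' ↦ hc.certifies I' hI' ω' fun h ↦ hω' (hST h)⟩

/-- A certificate at the exact level `X ω` has nonnegative weights, because `ω` itself may be
tested against it. Extended by zero, the weights bound the decrease of `X` by a weighted Hamming
distance whose squared norm is at most `r * d * X ω`. -/
lemma IsObservable.exists_weights {n : ℕ} {Ω : Fin n → Type*} {r d : ℝ} {X : (∀ i, Ω i) → ℝ}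
    {S : Set (∀ i, Ω i)} (hd : 0 ≤ d) (h : IsObservable r d X S) {ω : ∀ i, Ω i} (hω : ω ∉ S)
    (hX : 0 < X ω) :
    ∃ c : Fin n → ℝ, (∀ i, 0 ≤ c i) ∧ ∑ i, c i ^ 2 ≤ r * d * X ω ∧
      ∀ ω' ∉ S, X ω - ∑ i, {i | ω i ≠ ω' i}.indicator c i ≤ X ω' := by
  classical
  obtain ⟨I, c, hc⟩ := h (X ω) hX ω hω le_rfl
  have hc0 : ∀ i ∈ I, 0 ≤ c i := fun i hi ↦ by
    have := hc.certifies {i} (by simpa using hi) ω hω (fun _ _ ↦ rfl)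
    simp only [Finset.sum_singleton] at this
    linarith
  refine ⟨fun i ↦ if i ∈ I then c i else 0, fun i ↦ ?_, ?_, fun ω' hω' ↦ ?_⟩
  · dsimp only
    split_ifs with hi
    exacts [hc0 i hi, le_rfl]
  · calc ∑ i, (if i ∈ I then c i else 0) ^ 2 = ∑ i ∈ I, c i ^ 2 := by
          simp [ite_pow, Finset.sum_ite_mem]
      _ ≤ ∑ i ∈ I, c i * d := Finset.sum_le_sum fun i hi ↦ by
          nlinarith [hc0 i hi, hc.le_max i hi]
      _ = (∑ i ∈ I, c i) * d := by rw [Finset.sum_mul]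
      _ ≤ r * X ω * d := mul_le_mul_of_nonneg_right hc.sum_le hd
      _ = r * d * X ω := by ring
  · have := hc.certifies (I.filter fun i ↦ ω i ≠ ω' i) (Finset.filter_subset _ _) ω' hω'
      (fun i hi ↦ by
        simp only [Finset.mem_sdiff, Finset.mem_filter, not_and, not_not] at hi
        exact hi.2 hi.1)
    refine le_trans (le_of_eq ?_) this
    congr 1
    rw [Finset.sum_filter]
    simp only [Set.indicator, Set.mem_ofPred_eq]
    rw [← Finset.sum_subset (Finset.subset_univ I) (fun i _ hi ↦ by simp [hi])]
    refine Finset.sum_congr rfl fun i hi ↦ ?_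
    by_cases hi' : ω i = ω' i <;> simp [hi, hi']

/-- Two level sets of an observable function, with a free parameter `k`: the weights of the
certificates, scaled by `k`, are fed into the convex distance inequality. -/
lemma IsObservable.measure_mul_measure_le_exp {n : ℕ} {Ω : Fin n → Type*}
    [∀ i, MeasurableSpace (Ω i)] (μ : ∀ i, Measure (Ω i)) [∀ i, IsProbabilityMeasure (μ i)]
    {r d : ℝ} {X : (∀ i, Ω i) → ℝ} {S : Set (∀ i, Ω i)} (hS : MeasurableSet S)
    (hXm : Measurable X) (hd : 0 ≤ d) (h : IsObservable r d X S) {a s k : ℝ}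
    (hs : 0 < s) (hk : 0 ≤ k) (hkr : k * (r * d) ≤ 2) :
    (Measure.pi μ).real ({ω | X ω ≤ a} \ S) * (Measure.pi μ).real ({ω | s ≤ X ω} \ S) ≤
      Real.exp (-(2 * k * (s - a) - k ^ 2 * (r * d) * s) / 4) := by
  have hA : MeasurableSet ({ω | X ω ≤ a} \ S) := (measurableSet_le hXm measurable_const).diff hS
  obtain ⟨G, hGm, hG, hGd⟩ := exists_measurable_convexDistance_bound μ Finset.univ _ hA
  set A := {ω | X ω ≤ a} \ S with hAdef
  set B := {ω | s ≤ X ω} \ S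
  set q := (2 * k * (s - a) - k ^ 2 * (r * d) * s) / 4 with hq
  rcases isEmpty_or_nonempty (∀ i, Ω i) with he | ⟨⟨ω₀⟩⟩
  · rw [Set.eq_empty_of_isEmpty A]
    simp only [measureReal_empty, zero_mul]
    positivity
  have h1 : Measure.pi μ A * ∫⁻ ω, G ω ∂Measure.pi μ ≤ 1 := by
    have := hG ω₀
    rwa [← lintegral_eq_lmarginal_univ, ← lintegral_eq_lmarginal_univ,
      lintegral_indicator_one hA] at this
  have hsub : B ⊆ {ω | ENNReal.ofReal (Real.exp q) ≤ G ω} := by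
    rintro ω ⟨hω, hωS⟩
    have hω : s ≤ X ω := hω
    obtain ⟨c, hc0, hc2, hcX⟩ := h.exists_weights hd hωS (hs.trans_le hω)
    refine le_trans ?_ (hGd ω (k • c) (k * (X ω - a)) (fun i ↦ mul_nonneg hk (hc0 i)) ?_)
    · refine ENNReal.ofReal_le_ofReal (Real.exp_le_exp.2 ?_)
      have e : ∑ i, (k • c) i ^ 2 = k ^ 2 * ∑ i, c i ^ 2 := by
        rw [Finset.mul_sum]
        exact Finset.sum_congr rfl fun i _ ↦ by simp [mul_pow]
      rw [e]
      have h3 := mul_le_mul_of_nonneg_left hc2 (sq_nonneg k)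
      have h4 : 0 ≤ k * (2 - k * (r * d)) * (X ω - s) :=
        mul_nonneg (mul_nonneg hk (by linarith)) (by linarith)
      nlinarith
    · intro ω' hω' _
      have h5 := hcX ω' hω'.2
      have h6 : X ω' ≤ a := hω'.1
      have e : ∑ i, {i | ω i ≠ ω' i}.indicator (k • c) i =
          k * ∑ i, {i | ω i ≠ ω' i}.indicator c i := by
        rw [Finset.mul_sum]
        exact Finset.sum_congr rfl fun i _ ↦
          Set.indicator_const_smul_apply {i | ω i ≠ ω' i} k c i
      rw [e]
      exact mul_le_mul_of_nonneg_left (by linarith) hk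
  have h2 : Measure.pi μ B * ENNReal.ofReal (Real.exp q) ≤ ∫⁻ ω, G ω ∂Measure.pi μ :=
    calc _ ≤ ENNReal.ofReal (Real.exp q) *
          Measure.pi μ {ω | ENNReal.ofReal (Real.exp q) ≤ G ω} := by
          rw [mul_comm]; gcongr
      _ ≤ _ := mul_meas_ge_le_lintegral hGm _
  have h3 : Measure.pi μ A * (Measure.pi μ B * ENNReal.ofReal (Real.exp q)) ≤ 1 :=
    le_trans (by gcongr) h1
  have h4 := ENNReal.toReal_mono ENNReal.one_ne_top h3
  rw [ENNReal.toReal_mul, ENNReal.toReal_mul, ENNReal.toReal_ofReal (Real.exp_pos _).le,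
    ENNReal.toReal_one] at h4
  rw [neg_div, ← hq, Real.exp_neg, ← one_div, le_div_iff₀ (Real.exp_pos _), mul_assoc]
  exact h4

lemma IsObservable.measure_mul_measure_le {n : ℕ} {Ω : Fin n → Type*}
    [∀ i, MeasurableSpace (Ω i)] (μ : ∀ i, Measure (Ω i)) [∀ i, IsProbabilityMeasure (μ i)]
    {r d : ℝ} {X : (∀ i, Ω i) → ℝ} {S : Set (∀ i, Ω i)} (hS : MeasurableSet S)
    (hXm : Measurable X) (hX0 : ∀ ω, 0 ≤ X ω) (hd : 0 ≤ d) (h : IsObservable r d X S)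
    (hrd : 0 < r * d) {a b u : ℝ} (hu : 0 < u) (hab : a ≤ b) :
    (Measure.pi μ).real ({ω | X ω ≤ a} \ S) * (Measure.pi μ).real ({ω | a + u ≤ X ω} \ S) ≤
      Real.exp (-u ^ 2 / (4 * (r * d) * (b + u))) := by
  rcases lt_or_ge a 0 with ha | ha
  · have : {ω | X ω ≤ a} = ∅ := Set.eq_empty_of_forall_notMem fun ω hω ↦
      absurd (ha.trans_le (hX0 ω)) (not_lt.2 hω)
    simp only [this, Set.empty_sdiff, measureReal_empty, zero_mul]
    positivity
  · have hs : 0 < a + u := by linarith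
    -- `k` maximizes `2 * k * u - k ^ 2 * (r * d) * (a + u)`.
    refine (h.measure_mul_measure_le_exp μ hS hXm hd (a := a) hs (k := u / (r * d * (a + u)))
      (by positivity) ?_).trans (Real.exp_le_exp.2 ?_)
    · rw [div_mul_eq_mul_div, div_le_iff₀ (by positivity)]
      nlinarith
    · have e : -(2 * (u / (r * d * (a + u))) * (a + u - a) -
          (u / (r * d * (a + u))) ^ 2 * (r * d) * (a + u)) / 4 =
          -(u ^ 2 / (4 * (r * d) * (a + u))) := by
        field_simp
        ring
      rw [e, neg_div]
      gcongr

/-- If `r * d = 0`, the weights of all certificates vanish, so `X` is constant off `S`. -/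
lemma IsObservable.measure_mul_measure_eq_zero {n : ℕ} {Ω : Fin n → Type*}
    [∀ i, MeasurableSpace (Ω i)] (μ : ∀ i, Measure (Ω i)) [∀ i, IsProbabilityMeasure (μ i)]
    {r d : ℝ} {X : (∀ i, Ω i) → ℝ} {S : Set (∀ i, Ω i)}
    (hX0 : ∀ ω, 0 ≤ X ω) (hd : 0 ≤ d) (h : IsObservable r d X S)
    (hrd : r * d = 0) {a u : ℝ} (hu : 0 < u) :
    (Measure.pi μ).real ({ω | X ω ≤ a} \ S) * (Measure.pi μ).real ({ω | a + u ≤ X ω} \ S) = 0 := by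
  rcases ({ω | X ω ≤ a} \ S).eq_empty_or_nonempty with hA | ⟨ω', hω', hωS'⟩
  · simp [hA]
  have hω' : X ω' ≤ a := hω'
  have hB : {ω | a + u ≤ X ω} \ S = ∅ := by
    refine Set.eq_empty_of_forall_notMem ?_
    rintro ω ⟨hω, hωS⟩
    have hω : a + u ≤ X ω := hω
    obtain ⟨c, hc0, hc2, hcX⟩ := h.exists_weights hd hωS (by linarith [hX0 ω'])
    rw [hrd, zero_mul] at hc2
    have hc : ∀ i, c i = 0 := fun i ↦ by
      have := Finset.single_le_sum (fun i _ ↦ sq_nonneg (c i)) (Finset.mem_univ i)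
      exact pow_eq_zero_iff two_ne_zero |>.1 (le_antisymm (this.trans hc2) (sq_nonneg _))
    have := hcX ω' hωS'
    rw [Finset.sum_eq_zero fun i _ ↦ Set.indicator_apply_eq_zero.2 fun _ ↦ hc i] at this
    linarith
  simp [hB]

/-! ### Medians and integrals of tail bounds -/

lemma exists_median {α : Type*} [MeasurableSpace α] (P : Measure α) [IsProbabilityMeasure P]
    {X : α → ℝ} (hX : Measurable X) :
    ∃ m : ℝ, 1 / 2 ≤ P.real {ω | X ω ≤ m} ∧ 1 / 2 ≤ P.real {ω | m ≤ X ω} := by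
  set ν := P.map X
  have : IsProbabilityMeasure ν := Measure.isProbabilityMeasure_map hX.aemeasurable
  set F := ProbabilityTheory.cdf ν with hF
  have hFX : ∀ x, F x = P.real {ω | X ω ≤ x} := fun x ↦ by
    rw [hF, ProbabilityTheory.cdf_eq_real, map_measureReal_apply hX measurableSet_Iic]
    rfl
  set T : Set ℝ := {x | 1 / 2 ≤ F x} with hT
  have hTne : T.Nonempty := by
    have := (ProbabilityTheory.tendsto_cdf_atTop ν).eventually
      (eventually_ge_nhds (show (1 / 2 : ℝ) < 1 by norm_num))
    exact this.exists
  have hTbdd : BddBelow T := by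
    have := (ProbabilityTheory.tendsto_cdf_atBot ν).eventually
      (eventually_lt_nhds (show (0 : ℝ) < 1 / 2 by norm_num))
    obtain ⟨x, hx⟩ := this.exists
    refine ⟨x, fun y hy ↦ ?_⟩
    by_contra! hyx
    have h1 := F.mono hyx.le
    have h2 : 1 / 2 ≤ F y := hy
    linarith
  set m := sInf T
  have hgt : ∀ x, m < x → 1 / 2 ≤ F x := fun x hx ↦ by
    obtain ⟨y, hy, hyx⟩ := (csInf_lt_iff hTbdd hTne).1 hx
    exact le_trans hy (F.mono hyx.le)
  have hlt : ∀ x, x < m → F x < 1 / 2 := fun x hx ↦ by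
    by_contra! h
    exact absurd (csInf_le hTbdd h) (not_le.2 hx)
  refine ⟨m, ?_, ?_⟩
  · rw [← hFX]
    have h1 := (F.right_continuous m).mono Set.Ioi_subset_Ici_self
    exact ge_of_tendsto h1 (eventually_nhdsWithin_of_forall fun x hx ↦ hgt x hx)
  · have h1 : P.real {ω | X ω < m} ≤ 1 / 2 := by
      have h2 : Filter.Tendsto (fun k : ℕ ↦ P {ω | X ω ≤ m - 1 / ((k : ℝ) + 1)}) Filter.atTop
          (nhds (P (⋃ k : ℕ, {ω | X ω ≤ m - 1 / ((k : ℝ) + 1)}))) := by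
        refine tendsto_measure_iUnion_atTop fun i j hij ω hω ↦ ?_
        have hω : X ω ≤ m - 1 / ((i : ℝ) + 1) := hω
        exact hω.trans (sub_le_sub_left (Nat.one_div_le_one_div hij) m)
      have h3 : (⋃ k : ℕ, {ω | X ω ≤ m - 1 / ((k : ℝ) + 1)}) = {ω | X ω < m} := by
        ext ω
        simp only [Set.mem_iUnion, Set.mem_ofPred_eq]
        constructor
        · rintro ⟨k, hk⟩
          have := Nat.one_div_pos_of_nat (α := ℝ) (n := k)
          linarith
        · intro h
          obtain ⟨k, hk⟩ := exists_nat_one_div_lt (sub_pos.2 h)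
          exact ⟨k, by linarith⟩
      rw [h3] at h2
      have h4 : P {ω | X ω < m} ≤ ENNReal.ofReal (1 / 2) := by
        refine le_of_tendsto' h2 fun k ↦ ?_
        rw [← ENNReal.ofReal_toReal (measure_ne_top P {ω | X ω ≤ m - 1 / ((k : ℝ) + 1)})]
        refine ENNReal.ofReal_le_ofReal ?_
        have := hlt (m - 1 / ((k : ℝ) + 1)) (by
          have := Nat.one_div_pos_of_nat (α := ℝ) (n := k)
          linarith)
        rw [hFX] at this
        exact this.le
      exact ENNReal.toReal_le_of_le_ofReal (by norm_num) h4
    have h2 : {ω | m ≤ X ω} = {ω | X ω < m}ᶜ := by ext; simp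
    rw [h2, probReal_compl_eq_one_sub (measurableSet_lt hX measurable_const)]
    linarith

/-- The tail bound is at most a Gaussian plus an exponential, according to which of `2 * E` and
`u` is larger. -/
lemma lintegral_Ioi_exp_neg_sq_div_le {β E : ℝ} (hβ : 0 < β) (hE : 0 ≤ E) :
    ∫⁻ u in Set.Ioi (0 : ℝ), ENNReal.ofReal (Real.exp (-u ^ 2 / (4 * β * (2 * E + u)))) ≤
      ENNReal.ofReal (4 * √(β * E) + 8 * β) := by
  have hexp : ∫⁻ u in Set.Ioi (0 : ℝ), ENNReal.ofReal (Real.exp (-(1 / (8 * β)) * u)) =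
      ENNReal.ofReal (8 * β) := by
    rw [← ofReal_integral_eq_lintegral_ofReal (exp_neg_integrableOn_Ioi 0 (by positivity))
      (Filter.Eventually.of_forall fun _ ↦ (Real.exp_pos _).le),
      integral_exp_mul_Ioi (neg_lt_zero.2 (by positivity))]
    congr 1
    simp
  rcases hE.eq_or_lt with rfl | hE
  · simp only [mul_zero, Real.sqrt_zero, zero_add]
    rw [← hexp]
    refine setLIntegral_mono (by fun_prop) fun u (hu : 0 < u) ↦ ?_
    refine ENNReal.ofReal_le_ofReal (Real.exp_le_exp.2 ?_)
    have : -u ^ 2 / (4 * β * u) = -(1 / (8 * β)) * u * 2 := by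
      field_simp
      norm_num
    rw [this]
    have : 0 < 1 / (8 * β) * u := by positivity
    linarith
  · have hgauss : ∫⁻ u in Set.Ioi (0 : ℝ), ENNReal.ofReal (Real.exp (-(1 / (16 * β * E)) * u ^ 2)) ≤
        ENNReal.ofReal (4 * √(β * E)) := by
      rw [← ofReal_integral_eq_lintegral_ofReal
        (integrable_exp_neg_mul_sq (by positivity)).integrableOn
        (Filter.Eventually.of_forall fun _ ↦ (Real.exp_pos _).le), integral_gaussian_Ioi]
      refine ENNReal.ofReal_le_ofReal ?_
      have h1 : Real.pi / (1 / (16 * β * E)) ≤ 8 ^ 2 * (β * E) := by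
        rw [div_div_eq_mul_div, div_one]
        nlinarith [Real.pi_lt_four, mul_pos hβ hE]
      have h2 := Real.sqrt_le_sqrt h1
      rw [Real.sqrt_mul (by norm_num), Real.sqrt_sq (by norm_num)] at h2
      linarith
    calc _ ≤ ∫⁻ u in Set.Ioi (0 : ℝ), (ENNReal.ofReal (Real.exp (-(1 / (16 * β * E)) * u ^ 2)) +
          ENNReal.ofReal (Real.exp (-(1 / (8 * β)) * u))) := by
          refine setLIntegral_mono (by fun_prop) fun u (hu : 0 < u) ↦ ?_
          rcases le_total u (2 * E) with h | h
          · refine le_trans (ENNReal.ofReal_le_ofReal (Real.exp_le_exp.2 ?_)) le_self_add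
            rw [neg_mul, neg_div, one_div_mul_eq_div, neg_le_neg_iff]
            exact div_le_div_of_nonneg_left (sq_nonneg u) (by positivity) (by nlinarith)
          · refine le_trans (ENNReal.ofReal_le_ofReal (Real.exp_le_exp.2 ?_)) le_add_self
            rw [neg_mul, neg_div, one_div_mul_eq_div, neg_le_neg_iff,
              div_le_div_iff₀ (by positivity) (by positivity)]
            nlinarith [mul_pos hβ hu]
      _ ≤ ENNReal.ofReal (4 * √(β * E)) + ENNReal.ofReal (8 * β) := by
          rw [lintegral_add_left (by fun_prop), hexp]
          gcongr
      _ = _ := (ENNReal.ofReal_add (by positivity) (by positivity)).symm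

/-! ### Concentration around the expectation -/

lemma ofReal_integral_le_lintegral_ofReal {α : Type*} [MeasurableSpace α] {P : Measure α}
    {f : α → ℝ} (hf : Integrable f P) :
    ENNReal.ofReal (∫ ω, f ω ∂P) ≤ ∫⁻ ω, ENNReal.ofReal (f ω) ∂P := by
  rw [integral_eq_lintegral_pos_part_sub_lintegral_neg_part hf]
  exact (ENNReal.ofReal_le_ofReal (sub_le_self _ ENNReal.toReal_nonneg)).trans
    ENNReal.ofReal_toReal_le

/-- The expectation of `Z` is controlled by its tails outside `S` and by its supremum on `S`. -/
lemma lintegral_ofReal_le_of_tail {α : Type*} [MeasurableSpace α] {P : Measure α}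
    [IsFiniteMeasure P] {S : Set α} (hS : MeasurableSet S) {Z : α → ℝ} (hZ : Measurable Z)
    {M : ℝ≥0∞} (hZM : ∀ ω, ENNReal.ofReal (Z ω) ≤ M) {e : ℝ → ℝ} {κ : ℝ≥0∞}
    (htail : ∀ u, 0 < u → P.real ({ω | u ≤ Z ω} \ S) ≤ 4 * e u)
    (he : ∫⁻ u in Set.Ioi (0 : ℝ), ENNReal.ofReal (e u) ≤ κ) :
    ∫⁻ ω, ENNReal.ofReal (Z ω) ∂P ≤ 4 * κ + P S * M := by
  rw [← lintegral_add_compl _ hS, add_comm]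
  refine add_le_add ?_ ?_
  · have h0 : ∀ ω, ENNReal.ofReal (Z ω) = ENNReal.ofReal (max (Z ω) 0) := fun ω ↦ by
      rw [ENNReal.ofReal_max, ENNReal.ofReal_zero, max_eq_left (zero_le)]
    simp only [h0]
    rw [lintegral_eq_lintegral_meas_le _ (f := fun ω ↦ max (Z ω) 0)
      (Filter.Eventually.of_forall fun ω ↦ le_max_right _ _) (by fun_prop)]
    calc _ ≤ ∫⁻ u in Set.Ioi (0 : ℝ), 4 * ENNReal.ofReal (e u) := by
          refine setLIntegral_mono' measurableSet_Ioi fun u (hu : 0 < u) ↦ ?_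
          have h1 : {ω | u ≤ max (Z ω) 0} = {ω | u ≤ Z ω} := by
            ext ω
            simp [hu]
          rw [h1, Measure.restrict_apply (measurableSet_le measurable_const hZ),
            ← Set.sdiff_eq, ← ENNReal.ofReal_toReal (measure_ne_top P _)]
          refine (ENNReal.ofReal_le_ofReal (htail u hu)).trans (le_of_eq ?_)
          rw [ENNReal.ofReal_mul (by norm_num)]
          simp
      _ ≤ 4 * κ := by
          rw [lintegral_const_mul' _ _ (by simp)]
          gcongr
  · calc _ ≤ ∫⁻ _ in S, M ∂P := lintegral_mono fun ω ↦ hZM ω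
      _ = P S * M := by rw [setLIntegral_const, mul_comm]

/-- If two level sets at distance `u` off an exceptional set `S` have product of measures at most
`e u`, then `X` is concentrated around its expectation. The bound is proved around a median, which
lies within `4 * κ + P S * sup X ≤ t / 2` of the expectation. -/
theorem measure_abs_sub_integral_le_of_level_sets {α : Type*} [MeasurableSpace α] {P : Measure α}
    [IsProbabilityMeasure P] {S : Set α} (hS : MeasurableSet S) {X : α → ℝ} (hX : Measurable X)
    (hX0 : ∀ ω, 0 ≤ X ω) (hXi : Integrable X P) {e : ℝ → ℝ} {κ t : ℝ}
    (hlevel : ∀ a u, 0 < u → a ≤ 2 * ∫ ω, X ω ∂P →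
      P.real ({ω | X ω ≤ a} \ S) * P.real ({ω | a + u ≤ X ω} \ S) ≤ e u)
    (he : ∫⁻ u in Set.Ioi (0 : ℝ), ENNReal.ofReal (e u) ≤ ENNReal.ofReal κ)
    (ht0 : 0 < t)
    (ht : 8 * ENNReal.ofReal κ + 2 * P S * (⨆ ω, ENNReal.ofReal (X ω)) ≤ ENNReal.ofReal t) :
    P.real {ω | t < |X ω - ∫ ω', X ω' ∂P|} ≤ 4 * e (t / 2) + 4 * P.real S := by
  set E := ∫ ω, X ω ∂P with hE
  set M := ⨆ ω, ENNReal.ofReal (X ω)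
  have hE0 : 0 ≤ E := integral_nonneg hX0
  have he0 : 0 ≤ e (t / 2) :=
    (mul_nonneg measureReal_nonneg measureReal_nonneg).trans
      (hlevel 0 _ (half_pos ht0) (by linarith))
  rcases le_or_gt (1 / 4) (P.real S) with hp | hp
  · linarith [measureReal_le_one (μ := P) (s := {ω | t < |X ω - E|})]
  obtain ⟨m, hm1, hm2⟩ := exists_median P hX
  have hmE : m ≤ 2 * E := by
    rcases le_or_gt m 0 with h | h
    · linarith
    · have := mul_meas_ge_le_integral_of_nonneg (Filter.Eventually.of_forall hX0) hXi m
      nlinarith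
  have hA : 1 / 2 - P.real S ≤ P.real ({ω | X ω ≤ m} \ S) :=
    (sub_le_sub_right hm1 _).trans le_measureReal_sdiff
  have hB : 1 / 2 - P.real S ≤ P.real ({ω | m ≤ X ω} \ S) :=
    (sub_le_sub_right hm2 _).trans le_measureReal_sdiff
  have hup : ∀ u, 0 < u → (1 / 2 - P.real S) * P.real ({ω | m + u ≤ X ω} \ S) ≤ e u := fun u hu ↦
    (mul_le_mul_of_nonneg_right hA measureReal_nonneg).trans (hlevel m u hu hmE)
  have hdown : ∀ u, 0 < u → (1 / 2 - P.real S) * P.real ({ω | X ω ≤ m - u} \ S) ≤ e u := by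
    intro u hu
    have := hlevel (m - u) u hu (by linarith)
    rw [sub_add_cancel] at this
    refine le_trans ?_ this
    rw [mul_comm]
    exact mul_le_mul_of_nonneg_left hB measureReal_nonneg
  have hmM : ENNReal.ofReal m ≤ M := by
    have hne : {ω | m ≤ X ω}.Nonempty := by
      by_contra! h
      rw [h, measureReal_empty] at hm2
      linarith
    obtain ⟨ω, hω⟩ := hne
    exact (ENNReal.ofReal_le_ofReal hω).trans (le_iSup (fun ω ↦ ENNReal.ofReal (X ω)) ω)
  have hm0 : 0 ≤ m := by
    have hne : {ω | X ω ≤ m}.Nonempty := by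
      by_contra! h
      rw [h, measureReal_empty] at hm1
      linarith
    obtain ⟨ω, hω⟩ := hne
    exact (hX0 ω).trans hω
  have hhalf : ∀ x : ℝ, ENNReal.ofReal x ≤ 4 * ENNReal.ofReal κ + P S * M → x ≤ t / 2 := by
    intro x hx
    have h2 : ENNReal.ofReal (2 * x) ≤ ENNReal.ofReal t := by
      rw [ENNReal.ofReal_mul (by norm_num), ENNReal.ofReal_ofNat]
      refine (mul_le_mul_right hx 2).trans (le_trans (le_of_eq ?_) ht)
      ring
    have := (ENNReal.ofReal_le_ofReal_iff ht0.le).1 h2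
    linarith
  have hEm : E - m ≤ t / 2 := by
    refine hhalf _ ?_
    have h1 : E - m = ∫ ω, (X ω - m) ∂P := by
      rw [integral_sub hXi (integrable_const m)]; simp [hE]
    rw [h1]
    refine (ofReal_integral_le_lintegral_ofReal (hXi.sub (integrable_const m))).trans
      (lintegral_ofReal_le_of_tail hS (hX.sub_const m) (fun ω ↦ ?_) (fun u hu ↦ ?_) he)
    · exact (ENNReal.ofReal_le_ofReal (by simpa using hm0)).trans
        (le_iSup (fun ω ↦ ENNReal.ofReal (X ω)) ω)
    · have h2 : {ω | u ≤ X ω - m} = {ω | m + u ≤ X ω} := by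
        ext ω
        simp only [Set.mem_ofPred_eq]
        constructor <;> intro h <;> linarith
      have h3 := hup u hu
      rw [h2]
      nlinarith [measureReal_nonneg (μ := P) (s := {ω | m + u ≤ X ω} \ S)]
  have hmE' : m - E ≤ t / 2 := by
    refine hhalf _ ?_
    have h1 : m - E = ∫ ω, (m - X ω) ∂P := by
      rw [integral_sub (integrable_const m) hXi]; simp [hE]
    rw [h1]
    refine (ofReal_integral_le_lintegral_ofReal ((integrable_const m).sub hXi)).trans
      (lintegral_ofReal_le_of_tail hS (hX.const_sub m) (fun ω ↦ ?_) (fun u hu ↦ ?_) he)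
    · exact (ENNReal.ofReal_le_ofReal (by simpa using hX0 ω)).trans hmM
    · have h2 : {ω | u ≤ m - X ω} = {ω | X ω ≤ m - u} := by
        ext ω
        simp only [Set.mem_ofPred_eq]
        constructor <;> intro h <;> linarith
      have h3 := hdown u hu
      rw [h2]
      nlinarith [measureReal_nonneg (μ := P) (s := {ω | X ω ≤ m - u} \ S)]
  set U := {ω | m + t / 2 ≤ X ω} \ S
  set D := {ω | X ω ≤ m - t / 2} \ S
  have hsub : {ω | t < |X ω - E|} ⊆ (U ∪ D) ∪ S := by
    intro ω hω
    have hω : t < |X ω - E| := hω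
    by_cases hωS : ω ∈ S
    · exact Or.inr hωS
    · rcases lt_abs.1 hω with h | h
      · exact Or.inl (Or.inl ⟨by simp only [Set.mem_ofPred_eq]; linarith, hωS⟩)
      · exact Or.inl (Or.inr ⟨by simp only [Set.mem_ofPred_eq]; linarith, hωS⟩)
  have hD : MeasurableSet D := (measurableSet_le hX measurable_const).diff hS
  have hUD : Disjoint U D := by
    refine Set.disjoint_left.2 fun ω h1 h2 ↦ ?_
    have h1 : m + t / 2 ≤ X ω := h1.1
    have h2 : X ω ≤ m - t / 2 := h2.1
    linarith
  have hsum : P.real (U ∪ D) = P.real U + P.real D := measureReal_union hUD hD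
  have h1 : P.real (U ∪ D) ≤ 1 := measureReal_le_one
  have hU' := hup (t / 2) (half_pos ht0)
  have hD' := hdown (t / 2) (half_pos ht0)
  have h2 : P.real {ω | t < |X ω - E|} ≤ P.real (U ∪ D) + P.real S :=
    (measureReal_mono hsub).trans (measureReal_union_le _ _)
  -- With `y = P (U ∪ D) ≤ 1`, the two tail bounds add up to `(1 / 2 - P S) * y ≤ 2 * e (t / 2)`,
  -- hence `y ≤ 4 * e (t / 2) + 2 * P S`.
  have h3 : (1 / 2 - P.real S) * P.real (U ∪ D) ≤ 2 * e (t / 2) := by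
    rw [hsum]
    linarith
  nlinarith [mul_le_mul_of_nonneg_left h1 (measureReal_nonneg (μ := P) (s := S)),
    measureReal_nonneg (μ := P) (s := S)]

theorem mainTheorem12 {n : ℕ} {Ω : Fin n → Type*} [∀ i, MeasurableSpace (Ω i)]
    (μ : ∀ i, Measure (Ω i)) [∀ i, IsProbabilityMeasure (μ i)]
    (Ωs : Set (∀ i, Ω i))
    (X : (∀ i, Ω i) → ℝ) (hX_meas : Measurable X) (hX_nonneg : ∀ ω, 0 ≤ X ω)
    (hX_int : Integrable X (Measure.pi μ))
    (r d : ℝ) (hr : 0 ≤ r) (hd : 0 ≤ d)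
    (hobs : IsObservable r d X Ωs)
    (t : ℝ)
    (ht : ENNReal.ofReal (96 * √(r * d * ∫ ω, X ω ∂(Measure.pi μ)) + 128 * r * d)
        + 8 * Measure.pi μ Ωs * (⨆ ω, ENNReal.ofReal (X ω)) < ENNReal.ofReal t) :
    (0 < r * d →
      (Measure.pi μ).real {ω | t < |X ω - ∫ ω', X ω' ∂(Measure.pi μ)|} ≤
        4 * Real.exp (-t ^ 2 / (8 * r * d * (4 * (∫ ω, X ω ∂(Measure.pi μ)) + t)))
          + 4 * (Measure.pi μ).real Ωs) ∧
    (r * d = 0 →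
      (Measure.pi μ).real {ω | t < |X ω - ∫ ω', X ω' ∂(Measure.pi μ)|} ≤
        4 * (Measure.pi μ).real Ωs) := by
  -- Observability survives enlarging the exceptional set to a measurable set of equal measure.
  have hobs' := hobs.mono_exceptional (subset_toMeasurable (Measure.pi μ) Ωs)
  have hS := measurableSet_toMeasurable (Measure.pi μ) Ωs
  have hSm : Measure.pi μ (toMeasurable (Measure.pi μ) Ωs) = Measure.pi μ Ωs :=
    measure_toMeasurable _
  have hSr : (Measure.pi μ).real (toMeasurable (Measure.pi μ) Ωs) = (Measure.pi μ).real Ωs := by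
    rw [measureReal_def, hSm, measureReal_def]
  have ht0 : 0 < t := ENNReal.ofReal_pos.1 (bot_le.trans_lt ht)
  have hE0 : 0 ≤ ∫ ω, X ω ∂Measure.pi μ := integral_nonneg hX_nonneg
  set E := ∫ ω, X ω ∂Measure.pi μ with hE
  have hκ : 8 * ENNReal.ofReal (4 * √(r * d * E) + 8 * (r * d)) +
      2 * Measure.pi μ (toMeasurable (Measure.pi μ) Ωs) * (⨆ ω, ENNReal.ofReal (X ω)) ≤
        ENNReal.ofReal t := by
    rw [hSm]
    refine le_trans (add_le_add ?_ ?_) ht.le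
    · rw [← ENNReal.ofReal_ofNat 8, ← ENNReal.ofReal_mul (by norm_num)]
      refine ENNReal.ofReal_le_ofReal ?_
      nlinarith [Real.sqrt_nonneg (r * d * E), mul_nonneg hr hd]
    · gcongr
      norm_num
  rw [← hSr]
  constructor
  · intro hrd
    refine (measure_abs_sub_integral_le_of_level_sets hS hX_meas hX_nonneg hX_int
      (e := fun u ↦ Real.exp (-u ^ 2 / (4 * (r * d) * (2 * E + u))))
      (fun a u hu ha ↦ hobs'.measure_mul_measure_le μ hS hX_meas hX_nonneg hd hrd hu ha)
      (lintegral_Ioi_exp_neg_sq_div_le hrd hE0) ht0 hκ).trans (le_of_eq ?_)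
    have e : -(t / 2) ^ 2 / (4 * (r * d) * (2 * E + t / 2)) =
        -t ^ 2 / (8 * r * d * (4 * E + t)) := by
      rw [div_eq_div_iff (by positivity) (by
        have : 0 < 8 * (r * d) * (4 * E + t) := by positivity
        nlinarith)]
      ring
    simp only [e]
  · intro hrd
    have h := measure_abs_sub_integral_le_of_level_sets hS hX_meas hX_nonneg hX_int
      (e := fun _ ↦ 0)
      (fun a u hu _ ↦ (hobs'.measure_mul_measure_eq_zero μ hX_nonneg hd hrd hu).le)
      (by simp) ht0 hκ
    simpa using h
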